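/- Let $\mathbb F$ be a field of characteristic $p\ge 0$, let $n\ge 1$, and let $\mathbb U_1,\dots,\mathbb U_n$ be finite sets with $|\mathbb U_i|>1$ for all $i$. Put $\mathbb X=\mathbb U_1\times\cdots\times\mathbb U_n$ and $\mathbb E=\{0,1\}^n$. The factorial scheme of $\mathbb U_1,\dots,\mathbb U_n$ is the association scheme on $\mathbb X$ with relations $R_{\mathbf a}$ ($\mathbf a\in\mathbb E$), where $(\mathbf y,\mathbf z)\in R_{\mathbf a}$ if and only if, for every $i$, $\mathbf y_i=\mathbf z_i$ when $\mathbf a_i=0$ and $\mathbf y_i\ne\mathbf z_i$ when $\mathbf a_i=1$; that is, it is the direct product of the trivial schemes on $\mathbb U_1,\dots,\mathbb U_n$. Let $k_{\mathbf b}=|\{\mathbf z:(\mathbf y,\mathbf z)\in R_{\mathbf b}\}|$ be the valency of $R_{\mathbf b}$ (it does not depend on $\mathbf y\in\mathbb X$). Fix $\mathbf x\in\mathbb X$. Let $A_{\mathbf a}\in\mathrm M_{\mathbb X}(\mathbb F)$ be the adjacency matrix of $R_{\mathbf a}$, and let $E^*_{\mathbf a}\in\mathrm M_{\mathbb X}(\mathbb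 F)$ be the diagonal matrix whose $(\mathbf y,\mathbf y)$-entry is $1$ if $(\mathbf x,\mathbf y)\in R_{\mathbf a}$ and $0$ otherwise. Let $\mathbb T$ be the Terwilliger $\mathbb F$-algebra of the factorial scheme with respect to $\mathbf x$, i.e. the $\mathbb F$-subalgebra of $\mathrm M_{\mathbb X}(\mathbb F)$ generated by all $A_{\mathbf a}$ and $E^*_{\mathbf a}$ with $\mathbf a\in\mathbb E$, and let $\mathrm{Rad}(\mathbb T)$ be its Jacobson radical. Identify $\mathbf a\in\mathbb E$ with the set $\{i:\mathbf a_i=1\}\subseteq\{1,\dots,n\}$, write $\triangle$ for symmetric difference, and for $V\subseteq\{1,\dots,n\}$ put $V^\circ=\{i\in V:|\mathbb U_i|>2\}$. Let $\mathbb D$ be the set of all triples $(\mathbf a,\mathbf b,\mathbf c)\in\mathbb E^3$ such that $$\mathbf a\,\triangle\,\mathbf c\subseteq\mathbf b\subseteq(\mathbf a\,\triangle\,\mathbf c)\cup(\mathbf a\cap\mathbf c)^\circ\quad\text{and}\quad p\nmid k_{\mathbf b}$$ (for $p=0$ the last condition always holds). For $(\mathbf a,\mathbf b,\mathbf c),(\mathbf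 a',\mathbf b',\mathbf c')\in\mathbb D$ write $(\mathbf a,\mathbf b,\mathbf c)\sim(\mathbf a',\mathbf b',\mathbf c')$ if $(\mathbf a\cap\mathbf c)^\circ\setminus\mathbf b=(\mathbf a'\cap\mathbf c')^\circ\setminus\mathbf b'$. Let $\mathbb D_1,\dots,\mathbb D_{n_\sim}$ be the distinct equivalence classes of $\sim$, and put $\mathbb D(g)=\{\mathbf a\in\mathbb E:(\mathbf a,\mathbf b,\mathbf a)\in\mathbb D_g\text{ for some }\mathbf b\in\mathbb E\}$. Then $$\mathbb T/\mathrm{Rad}(\mathbb T)\;\cong\;\bigoplus_{g=1}^{n_\sim}\mathrm M_{|\mathbb D(g)|}(\mathbb F)\qquad\text{as }\mathbb F\text{-algebras}.$$ -/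

import Mathlib

open scoped symmDiff

universe u v w

/-- An association scheme on the nonempty finite set `X` whose relations are indexed by the
finite set `E`: the `R a` are nonempty and partition `X × X`, one of them is the diagonal, the
transpose of each is again one of them, and the intersection numbers are well defined.
(As the relations are nonempty and disjoint, `zero` and `star` are determined by `R`.) -/
structure AssocScheme (X : Type u) (E : Type v) [Finite X] [Nonempty X] [Finite E] where
  /-- The relations. -/
  R : E → Set (X × X)
  /-- The index of the diagonal relation. -/
  zero : E
  /-- The index of the transposed relation. -/
  star : E → E
  R_nonempty : ∀ a, (R a).Nonempty
  R_partition : ∀ q : X × X, ∃! a, q ∈ R a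
  R_zero : R zero = {q | q.1 = q.2}
  R_star : ∀ g, R (star g) = {q | (q.2, q.1) ∈ R g}
  regular : ∀ (g h i : E) (q q' : X × X), q ∈ R i → q' ∈ R i →
    {a | (q.1, a) ∈ R g ∧ (a, q.2) ∈ R h}.ncard = {a | (q'.1, a) ∈ R g ∧ (a, q'.2) ∈ R h}.ncard

namespace AssocScheme

section General

variable {X : Type u} {E : Type v} [Finite X] [Nonempty X] [Finite E]

/-- The intersection number `p_{g,h}^i`: the number of `a` with `(x,a) ∈ R g` and `(a,y) ∈ R h`
for some, equivalently every, `(x,y) ∈ R i`. -/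
noncomputable def interNum (S : AssocScheme X E) (g h i : E) : ℕ :=
  {a | ((S.R_nonempty i).some.1, a) ∈ S.R g ∧ (a, (S.R_nonempty i).some.2) ∈ S.R h}.ncard

theorem interNum_eq (S : AssocScheme X E) {g h i : E} {x y : X} (hxy : (x, y) ∈ S.R i) :
    S.interNum g h i = {a | (x, a) ∈ S.R g ∧ (a, y) ∈ S.R h}.ncard :=
  S.regular g h i _ (x, y) (S.R_nonempty i).some_mem hxy

/-- The valency `k_g = p_{g,g*}^0`. -/
noncomputable def valency (S : AssocScheme X E) (g : E) : ℕ :=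
  S.interNum g (S.star g) S.zero

theorem valency_eq (S : AssocScheme X E) (g : E) (x : X) :
    S.valency g = {a | (x, a) ∈ S.R g}.ncard := by
  have h : (x, x) ∈ S.R S.zero := by rw [S.R_zero]; rfl
  rw [valency, S.interNum_eq h, S.R_star]
  simp

end General

section Terwilliger

variable (F : Type w) [Field F] {X : Type u} {E : Type v} [Fintype X] [DecidableEq X] [Nonempty X]
  [Finite E]

open Classical in
/-- The adjacency matrix `A_g` over `F`. -/
noncomputable def adjacency (S : AssocScheme X E) (g : E) : Matrix X X F :=
  Matrix.of fun y z => if (y, z) ∈ S.R g then 1 else 0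

open Classical in
/-- The dual idempotent `E_g^*(x)` over `F`. -/
noncomputable def dualIdempotent (S : AssocScheme X E) (x : X) (g : E) : Matrix X X F :=
  Matrix.diagonal fun y => if (x, y) ∈ S.R g then 1 else 0

/-- The Terwilliger algebra over `F` of the scheme `S` with respect to the point `x`. -/
def terwilligerAlgebra (S : AssocScheme X E) (x : X) : Subalgebra F (Matrix X X F) :=
  Algebra.adjoin F (Set.range (S.adjacency F) ∪ Set.range (S.dualIdempotent F x))

end Terwilliger

/-- The trivial scheme on a finite set with more than one element: `R 0` is the diagonal and
`R 1` is its complement. -/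
def trivialScheme (V : Type u) [Finite V] [Nontrivial V] : AssocScheme V (Fin 2) where
  R a := {q | q.1 = q.2 ↔ a = 0}
  zero := 0
  star a := a
  R_nonempty a := by
    obtain ⟨x, y, hxy⟩ := exists_pair_ne V
    fin_cases a
    · exact ⟨(x, x), by simp⟩
    · exact ⟨(x, y), by simp [hxy]⟩
  R_partition q := by
    by_cases h : q.1 = q.2
    · exact ⟨0, by simp [h], fun b hb => by simpa [h] using hb⟩
    · refine ⟨1, by simp [h], fun b hb => ?_⟩
      have hb' : b ≠ 0 := by simpa [h] using hb
      omega
  R_zero := by simp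
  R_star g := by ext q; simp [eq_comm]
  regular g h i q q' hq hq' := by
    classical
    obtain ⟨x, y⟩ := q
    obtain ⟨x', y'⟩ := q'
    have key : (x = y ↔ x' = y') := by
      simp only [Set.mem_ofPred_eq] at hq hq'
      rw [hq, hq']
    obtain ⟨σ, hx, hy⟩ : ∃ σ : Equiv.Perm V, σ x = x' ∧ σ y = y' := by
      by_cases hxy : x = y
      · refine ⟨Equiv.swap x x', by simp, ?_⟩
        rw [← hxy, ← key.1 hxy]; simp
      · have hxy' : x' ≠ y' := fun e => hxy (key.2 e)
        have hne : Equiv.swap x x' y ≠ x' := by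
          intro e
          apply hxy
          apply (Equiv.swap x x').injective
          rw [e]; simp
        refine ⟨(Equiv.swap x x').trans (Equiv.swap (Equiv.swap x x' y) y'), ?_, by simp⟩
        simp only [Equiv.trans_apply, Equiv.swap_apply_left]
        exact Equiv.swap_apply_of_ne_of_ne hne.symm hxy'
    refine Set.ncard_congr (fun a _ => σ a) ?_ (fun a b _ _ e => σ.injective e) ?_
    · rintro a ⟨h1, h2⟩
      subst hx hy
      simpa using And.intro h1 h2
    · rintro b ⟨h1, h2⟩
      subst hx hy
      refine ⟨σ.symm b, ?_, by simp⟩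
      obtain ⟨a, rfl⟩ := σ.surjective b
      simpa using And.intro h1 h2

/-- The direct product of the schemes `S h`, `1 ≤ h ≤ n`. -/
def directProduct {n : ℕ} {X : Fin n → Type u} {E : Fin n → Type v} [∀ h, Finite (X h)]
    [∀ h, Nonempty (X h)] [∀ h, Finite (E h)] (S : ∀ h, AssocScheme (X h) (E h)) :
    AssocScheme (∀ h, X h) (∀ h, E h) where
  R a := {q | ∀ h, (q.1 h, q.2 h) ∈ (S h).R (a h)}
  zero h := (S h).zero
  star a h := (S h).star (a h)
  R_nonempty a := by
    choose q hq using fun h => (S h).R_nonempty (a h)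
    exact ⟨(fun h => (q h).1, fun h => (q h).2), hq⟩
  R_partition q := by
    choose a ha hu using fun h => (S h).R_partition (q.1 h, q.2 h)
    exact ⟨a, ha, fun b hb => funext fun h => hu h (b h) (hb h)⟩
  R_zero := by
    ext q
    simp [R_zero, funext_iff]
  R_star g := by
    ext q
    simp [R_star]
  regular g k i q q' hq hq' := by
    have key : ∀ r : (∀ h, X h) × (∀ h, X h),
        {a : ∀ h, X h | (∀ h, (r.1 h, a h) ∈ (S h).R (g h)) ∧ ∀ h, (a h, r.2 h) ∈ (S h).R (k h)}.ncard
          = ∏ h, {a | (r.1 h, a) ∈ (S h).R (g h) ∧ (a, r.2 h) ∈ (S h).R (k h)}.ncard := by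
      intro r
      simp only [← Nat.card_coe_set_eq, ← forall_and]
      rw [← Nat.card_pi]
      exact Nat.card_congr (Equiv.subtypePiEquivPi
        (p := fun h a => (r.1 h, a) ∈ (S h).R (g h) ∧ (a, r.2 h) ∈ (S h).R (k h)))
    refine (key q).trans (Eq.trans ?_ (key q').symm)
    exact Finset.prod_congr rfl fun h _ =>
      (S h).regular (g h) (k h) (i h) (q.1 h, q.2 h) (q'.1 h, q'.2 h) (hq h) (hq' h)

end AssocScheme

namespace Factorial

open AssocScheme

variable {n : ℕ} (U : Fin n → Type u) [∀ i, Fintype (U i)] [∀ i, Nontrivial (U i)] (p : ℕ)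

/-- The factorial scheme: the direct product of the trivial schemes on `U 1, …, U n`. -/
def scheme : AssocScheme (∀ i, U i) (Fin n → Fin 2) :=
  directProduct fun i => trivialScheme (U i)

/-- The set of coordinates of a `0`-`1`-tuple at which the entry is `1`. -/
def supp (g : Fin n → Fin 2) : Finset (Fin n) := {i | g i = 1}

/-- `V°`: the indices in `V` with `|U i| > 2`. -/
def big (V : Finset (Fin n)) : Finset (Fin n) := {i ∈ V | 2 < Fintype.card (U i)}

/-- The triples `(a, b, c)` with `a △ c ⊆ b ⊆ (a △ c) ∪ (a ∩ c)°`. -/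
def triples : Set ((Fin n → Fin 2) × (Fin n → Fin 2) × (Fin n → Fin 2)) :=
  {t | supp t.1 ∆ supp t.2.2 ⊆ supp t.2.1 ∧
    supp t.2.1 ⊆ (supp t.1 ∆ supp t.2.2) ∪ big U (supp t.1 ∩ supp t.2.2)}

/-- The triples `(a, b, c)` as above for which `p` does not divide the valency `k_b`. -/
def regularTriples : Set ((Fin n → Fin 2) × (Fin n → Fin 2) × (Fin n → Fin 2)) :=
  {t | t ∈ triples U ∧ ¬ p ∣ (scheme U).valency t.2.1}

/-- `(a, b, c) ∼ (a', b', c')` if and only if `(a ∩ c)° \ b = (a' ∩ c')° \ b'`. -/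
def tripleSetoid : Setoid (regularTriples U p) :=
  Setoid.ker fun t => big U (supp t.1.1 ∩ supp t.1.2.2) \ supp t.1.2.1

/-- The set of equivalence classes of `∼`. -/
abbrev Classes : Type := Quotient (tripleSetoid U p)

/-- For a class `m`, the set of all `a` for which some `(a, b, a)` belongs to `m`. -/
def diagIndices (m : Classes U p) : Set (Fin n → Fin 2) :=
  {a | ∃ (b : Fin n → Fin 2) (h : (a, b, a) ∈ regularTriples U p),
    Quotient.mk (tripleSetoid U p) ⟨(a, b, a), h⟩ = m}

end Factorial

/-!
The Terwilliger algebra of a direct product of schemes is the tensor product of the Terwilliger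
algebras of the factors (`AssocScheme.isTensorDecomposition_terwilligerTensor`), realised inside the
matrices on the product set by Kronecker products. So everything is decided in one factor.

For the trivial scheme on `V` with base point `x`, the Terwilliger algebra consists of the matrices
`pointed x α β γ δ ε`, whose product is given by a closed formula in which only `N = |V| - 1`
enters. With respect to the invariant vectors `e_x` and `∑_{z ≠ x} e_z` such a matrix acts as
`!![α, N β; γ, δ + N ε]`; on differences `e_v - e_w` with `v, w ≠ x`, which exist exactly when
`|V| > 2`, it acts as the scalar `δ`. If `N ≠ 0` in `F`, these two representations identify the
algebra with `M₂(F) × F` (or with `M₂(F)` if `|V| = 2`). If `N = 0` in `F`, the first one is lower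
triangular; its upper left entry and the scalar `δ` give a surjection onto `F × F` whose kernel has
cube zero. Both cases are one statement, `TrivialScheme.exists_algHom_blocks`: the algebra surjects
onto a product of matrix algebras with a kernel in which all products of three elements vanish.

Such surjections multiply along a tensor product
(`IsTensorDecomposition.nonempty_quotient_jacobson_algEquiv`): the product of the surjections is a
surjection onto a product of matrix algebras, which is semisimple, and its kernel is generated by
pure tensors having a factor in one of the kernels. These lie in the Jacobson radical as the cube
of every multiple of one of them is zero, so the kernel is the radical.

The blocks of the product are indexed by the sets `W` of coordinates `i` with `|U i| > 2` (those
where the scalar block is chosen), and the rows of the block `W` by the `a` with `a i = 1` for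
`i ∈ W` and `a i = 0` for those `i ∉ W` with `p ∣ |U i| - 1`. The invariant `(a ∩ c)° \ b` of a
triple is such a `W`, and the set of rows is the set of diagonal indices of the corresponding class
(`Factorial.bijective_blockOfClass`, `Factorial.mem_diagIndices_iff`).
-/

/-! ### Tensor products of algebras with nilpotent radical -/

section TensorProduct

theorem pi_matrix_eq_sum_single {R K : Type*} [Semiring R] [Fintype K] [DecidableEq K]
    {Q : K → Type*} [∀ k, Fintype (Q k)] [∀ k, DecidableEq (Q k)]
    (N : ∀ k, Matrix (Q k) (Q k) R) :
    N = ∑ k, ∑ a, ∑ c, N k a c •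
      (Pi.single k (Matrix.single a c 1) : ∀ k, Matrix (Q k) (Q k) R) := by
  conv_lhs => rw [← Finset.univ_sum_single N]
  refine Finset.sum_congr rfl fun k _ => ?_
  conv_lhs => rw [Matrix.matrix_eq_sum_single (N k)]
  change LinearMap.single R (fun k => Matrix (Q k) (Q k) R) k _ = _
  simp only [map_sum]
  refine Finset.sum_congr rfl fun a _ => Finset.sum_congr rfl fun c _ => ?_
  rw [LinearMap.single_apply, ← Pi.single_smul, Matrix.smul_single, smul_eq_mul, mul_one]

variable {F : Type*} [Field F] {ι : Type*} [Fintype ι]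
  {A : ι → Type*} [∀ i, Ring (A i)] [∀ i, Algebra F (A i)] {B : Type*} [Ring B] [Algebra F B]

/-- The algebra `B` is, via the multilinear map `τ`, the tensor product of the algebras `A i`: `τ` is
multiplicative, its values span `B`, and products of linear functionals on the `A i` extend to `B`.
The last condition replaces linear independence of the pure tensors `τ m`. -/
structure IsTensorDecomposition (τ : MultilinearMap F A B) : Prop where
  apply_one : τ 1 = 1
  apply_mul : ∀ m m', τ (m * m') = τ m * τ m'
  span_range : Submodule.span F (Set.range τ) = ⊤
  exists_functional : ∀ g : ∀ i, A i →ₗ[F] F, ∃ G : B →ₗ[F] F, ∀ m, G (τ m) = ∏ i, g i (m i)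

namespace IsTensorDecomposition

variable {τ : MultilinearMap F A B}

/-- Induction over linear combinations of pure tensors. -/
theorem induction (hτ : IsTensorDecomposition τ) {P : B → Prop} (pure : ∀ m, P (τ m))
    (add : ∀ b b', P b → P b' → P (b + b')) (smul : ∀ (c : F) b, P b → P (c • b)) (b : B) :
    P b := by
  have hb : b ∈ Submodule.span F (Set.range τ) := hτ.span_range ▸ Submodule.mem_top
  induction hb using Submodule.span_induction with
  | mem x hx => obtain ⟨m, rfl⟩ := hx; exact pure m
  | zero => simpa using smul 0 _ (pure 0)
  | add x y _ _ hx hy => exact add _ _ hx hy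
  | smul c x _ hx => exact smul _ _ hx

/-- A pure tensor lies in the Jacobson radical if the two-sided multiples of one of its factors have
vanishing triple products. -/
theorem mem_jacobson_of_cube (hτ : IsTensorDecomposition τ) {m : ∀ i, A i} {i : ι}
    (hm : ∀ a b, m i * a * m i * b * m i = 0) : τ m ∈ Ring.jacobson B := by
  -- By bilinearity it suffices to take pure tensors, where one factor of the product vanishes.
  have key : ∀ b b' : B, τ m * b * τ m * b' * τ m = 0 := by
    intro b b'
    induction b using hτ.induction with
    | pure k =>
      induction b' using hτ.induction with
      | pure k' =>
        simp only [← hτ.apply_mul]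
        exact τ.map_coord_zero i (hm _ _)
      | add x y hx hy => rw [mul_add, add_mul, hx, hy, add_zero]
      | smul c x hx => rw [mul_smul_comm, smul_mul_assoc, hx, smul_zero]
    | add x y hx hy => simp only [mul_add, add_mul, hx, hy, add_zero]
    | smul c x hx => simp only [mul_smul_comm, smul_mul_assoc, hx, smul_zero]
  rw [Ring.jacobson_eq_sInf_isMaximal]
  suffices h : τ m ∈ Ideal.jacobson (⊥ : Ideal B) by simpa [Ideal.jacobson] using h
  -- As `(y * τ m) ^ 3 = 0`, the geometric series for the inverse of `1 + y * τ m` has three terms.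
  refine Ideal.mem_jacobson_iff.2 fun y => ⟨1 - y * τ m + y * τ m * y * τ m, ?_⟩
  have h3 : y * τ m * y * τ m * y * τ m = 0 := by
    have := congrArg (y * ·) (key y y)
    simpa [mul_assoc] using this
  rw [Ideal.mem_bot]
  calc _ = y * τ m * y * τ m * y * τ m := by noncomm_ring
    _ = 0 := h3

/-- Pure tensors whose factors agree up to elements with vanishing triple products agree modulo the
Jacobson radical. -/
theorem sub_mem_jacobson_of_cube (hτ : IsTensorDecomposition τ) {m m' : ∀ i, A i}
    (h : ∀ i a b, (m i - m' i) * a * (m i - m' i) * b * (m i - m' i) = 0) :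
    τ m - τ m' ∈ Ring.jacobson B := by
  classical
  have hm : τ m = ∑ s : Finset ι, τ (s.piecewise m' (m - m')) := by
    rw [← τ.map_add_univ, add_sub_cancel]
  rw [hm, ← Finset.sum_erase_add _ _ (Finset.mem_univ Finset.univ), Finset.piecewise_univ,
    add_sub_cancel_right]
  refine Ideal.sum_mem _ fun s hs => ?_
  obtain ⟨i, hi⟩ : ∃ i, i ∉ s := by
    by_contra! hs'
    exact (Finset.mem_erase.1 hs).1 (Finset.eq_univ_iff_forall.2 hs')
  refine hτ.mem_jacobson_of_cube (i := i) fun a b => ?_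
  rw [Finset.piecewise_eq_of_notMem _ _ _ hi]
  exact h i a b

/-- Matrix representations of the factors multiply to matrix representations of the tensor
product, one for each choice of a block in every factor. -/
theorem exists_algHom (hτ : IsTensorDecomposition τ) [DecidableEq ι] {K : ι → Type*}
    {Q : ∀ i, K i → Type*} [∀ i k, Fintype (Q i k)] [∀ i k, DecidableEq (Q i k)]
    (ψ : ∀ i, A i →ₐ[F] ∀ k : K i, Matrix (Q i k) (Q i k) F) :
    ∃ Φ : B →ₐ[F] ∀ k : ∀ i, K i, Matrix (∀ i, Q i (k i)) (∀ i, Q i (k i)) F,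
      ∀ m k a c, Φ (τ m) k a c = ∏ i, ψ i (m i) (k i) (a i) (c i) := by
  have hG : ∀ (k : ∀ i, K i) (a c : ∀ i, Q i (k i)), ∃ G : B →ₗ[F] F,
      ∀ m, G (τ m) = ∏ i, ψ i (m i) (k i) (a i) (c i) := fun k a c =>
    hτ.exists_functional fun i => Matrix.entryLinearMap F F (a i) (c i) ∘ₗ
      (LinearMap.proj (k i) : (∀ k : K i, Matrix (Q i k) (Q i k) F) →ₗ[F] _) ∘ₗ
      (ψ i).toLinearMap
  choose G hG using hG
  let Φ : B →ₗ[F] ∀ k : ∀ i, K i, Matrix (∀ i, Q i (k i)) (∀ i, Q i (k i)) F :=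
    { toFun := fun b k => Matrix.of fun a c => G k a c b
      map_add' := fun b b' => by ext; simp
      map_smul' := fun r b => by ext; simp }
  refine ⟨AlgHom.ofLinearMap Φ ?_ ?_, fun m k a c => hG k a c m⟩
  · ext k a c
    rw [← hτ.apply_one]
    change G k a c _ = _
    rw [hG]
    simp [Matrix.one_apply, Finset.prod_ite_zero, funext_iff]
  · intro b b'
    induction b using hτ.induction with
    | pure m =>
      induction b' using hτ.induction with
      | pure m' =>
        ext k a c
        rw [← hτ.apply_mul]
        change G k a c _ = ∑ d, G k a d _ * G k d c _
        have hmul : ∀ i, ψ i ((m * m') i) (k i) (a i) (c i) =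
            ∑ d, ψ i (m i) (k i) (a i) d * ψ i (m' i) (k i) d (c i) := fun i =>
          congrFun (congrFun (congrFun (map_mul (ψ i) (m i) (m' i)) (k i)) (a i)) (c i)
        simp only [hG, hmul, ← Finset.prod_mul_distrib]
        rw [Finset.prod_univ_sum, Fintype.piFinset_univ]
      | add x y hx hy => rw [mul_add, map_add, map_add, hx, hy, mul_add]
      | smul c x hx => rw [mul_smul_comm, map_smul, map_smul, hx, mul_smul_comm]
    | add x y hx hy => rw [add_mul, map_add, map_add, hx, hy, add_mul]
    | smul c x hx => rw [smul_mul_assoc, map_smul, map_smul, hx, smul_mul_assoc]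

/-- If each `A i` maps onto a product of matrix algebras and triple products in the kernels vanish,
then the tensor product modulo its Jacobson radical is the product of the matrix algebras obtained
by choosing a block in every factor. -/
theorem nonempty_quotient_jacobson_algEquiv (hτ : IsTensorDecomposition τ) [DecidableEq ι]
    {K : ι → Type*} [∀ i, Fintype (K i)] [∀ i, DecidableEq (K i)]
    {Q : ∀ i, K i → Type*} [∀ i k, Fintype (Q i k)] [∀ i k, DecidableEq (Q i k)]
    (ψ : ∀ i, A i →ₐ[F] ∀ k : K i, Matrix (Q i k) (Q i k) F)
    (hψ : ∀ i, Function.Surjective (ψ i))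
    (hker : ∀ i a b c, ψ i a = 0 → ψ i b = 0 → ψ i c = 0 → a * b * c = 0) :
    Nonempty ((B ⧸ Ring.jacobson B) ≃ₐ[F]
      ∀ k : ∀ i, K i, Matrix (∀ i, Q i (k i)) (∀ i, Q i (k i)) F) := by
  obtain ⟨Φ, hΦ⟩ := hτ.exists_algHom ψ
  let J : ι → Type _ := fun i => Σ k : K i, Q i k × Q i k
  choose e he using fun (i : ι) (j : J i) =>
    hψ i (Pi.single j.1 (Matrix.single j.2.1 j.2.2 1))
  -- Tensor products of preimages of matrix units are preimages of matrix units.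
  have hunit : ∀ (k : ∀ i, K i) (a c : ∀ i, Q i (k i)),
      Φ (τ fun i => e i ⟨k i, a i, c i⟩) = Pi.single k (Matrix.single a c 1) := by
    intro k a c
    ext k' a' c'
    rw [hΦ]
    simp only [he]
    by_cases hk : k' = k
    · subst hk
      simp [Matrix.single_apply, Finset.prod_ite_zero, funext_iff, forall_and]
    · obtain ⟨i, hi⟩ := Function.ne_iff.1 hk
      rw [Pi.single_eq_of_ne hk]
      exact Finset.prod_eq_zero (Finset.mem_univ i) (by rw [Pi.single_eq_of_ne hi]; rfl)
  have hsurj : Function.Surjective Φ := by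
    intro N
    refine ⟨∑ k, ∑ a, ∑ c, N k a c • τ fun i => e i ⟨k i, a i, c i⟩, ?_⟩
    simp only [map_sum, map_smul, hunit]
    exact (pi_matrix_eq_sum_single N).symm
  -- Modulo the radical, every element is the combination of these preimages given by `Φ`.
  have hdiff : ∀ b, b - ∑ j : ∀ i, J i,
      Φ b (fun i => (j i).1) (fun i => (j i).2.1) (fun i => (j i).2.2) • τ (fun i => e i (j i))
        ∈ Ring.jacobson B := by
    intro b
    induction b using hτ.induction with
    | pure m =>
      have : ∑ j : ∀ i, J i, Φ (τ m) (fun i => (j i).1) (fun i => (j i).2.1)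
          (fun i => (j i).2.2) • τ (fun i => e i (j i)) =
          τ fun i => ∑ j : J i, ψ i (m i) j.1 j.2.1 j.2.2 • e i j := by
        rw [τ.map_sum]
        simp only [hΦ, τ.map_smul_univ]
      rw [this]
      refine hτ.sub_mem_jacobson_of_cube fun i a b => ?_
      have h0 : ψ i (m i - ∑ j : J i, ψ i (m i) j.1 j.2.1 j.2.2 • e i j) = 0 := by
        rw [map_sub, sub_eq_zero, map_sum]
        simp only [map_smul, he]
        rw [Fintype.sum_sigma]
        simp only [Fintype.sum_prod_type]
        exact pi_matrix_eq_sum_single _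
      have hl : ∀ z r, ψ i r = 0 → ψ i (z * r) = 0 := fun z r hr =>
        (map_mul (ψ i) z r).trans (by rw [hr, mul_zero])
      simpa only [mul_assoc] using hker i _ _ _ h0 (hl a _ h0) (hl b _ h0)
    | add x y hx hy =>
      convert! Ideal.add_mem _ hx hy using 1
      simp only [map_add, Pi.add_apply, Matrix.add_apply, add_smul, Finset.sum_add_distrib]
      abel
    | smul c x hx =>
      convert! Submodule.smul_of_tower_mem (Ring.jacobson B) c hx using 1
      simp only [map_smul, Pi.smul_apply, Matrix.smul_apply, smul_sub, Finset.smul_sum, smul_smul,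
        smul_eq_mul]
  have hkerΦ : RingHom.ker Φ = Ring.jacobson B := by
    apply le_antisymm
    · intro b hb
      have := hdiff b
      rw [(RingHom.mem_ker).1 hb] at this
      simpa using this
    · -- The target is semisimple, so the radical of `B` maps to zero.
      have : RingHomSurjective Φ.toRingHom := ⟨hsurj⟩
      have h := Ring.le_comap_jacobson Φ.toRingHom
      rwa [IsSemisimpleRing.jacobson_eq_bot
        (∀ k : ∀ i, K i, Matrix (∀ i, Q i (k i)) (∀ i, Q i (k i)) F)] at h
  exact ⟨(Ideal.quotientEquivAlgOfEq F hkerΦ.symm).trans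
    (Ideal.quotientKerAlgEquivOfSurjective hsurj)⟩

end IsTensorDecomposition
end TensorProduct

/-! ### Terwilliger algebras of direct products -/

section PiKronecker

variable {ι : Type*} [Fintype ι] {X : ι → Type*} {F : Type*}

variable (F X) in
/-- The Kronecker product of a finite family of square matrices, as a multilinear map. -/
noncomputable def Matrix.piKronecker [CommRing F] :
    MultilinearMap F (fun i => Matrix (X i) (X i) F) (Matrix (∀ i, X i) (∀ i, X i) F) where
  toFun m := Matrix.of fun y z => ∏ i, m i (y i) (z i)
  map_update_add' := by
    intro _ m i a b
    ext y z
    simp only [Matrix.of_apply, Matrix.add_apply]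
    rw [← Finset.mul_prod_erase _ _ (Finset.mem_univ i),
      ← Finset.mul_prod_erase _ _ (Finset.mem_univ i),
      ← Finset.mul_prod_erase _ _ (Finset.mem_univ i)]
    simp only [Function.update_self, Matrix.add_apply, add_mul]
    congr 2 <;> exact Finset.prod_congr rfl fun j hj => by
      rw [Function.update_of_ne (Finset.ne_of_mem_erase hj),
        Function.update_of_ne (Finset.ne_of_mem_erase hj)]
  map_update_smul' := by
    intro _ m i c a
    ext y z
    simp only [Matrix.of_apply, Matrix.smul_apply]
    rw [← Finset.mul_prod_erase _ _ (Finset.mem_univ i),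
      ← Finset.mul_prod_erase _ _ (Finset.mem_univ i)]
    simp only [Function.update_self, Matrix.smul_apply, smul_eq_mul, mul_assoc]
    congr 2
    exact Finset.prod_congr rfl fun j hj => by
      rw [Function.update_of_ne (Finset.ne_of_mem_erase hj),
        Function.update_of_ne (Finset.ne_of_mem_erase hj)]

namespace Matrix

theorem piKronecker_apply [CommRing F] (m : ∀ i, Matrix (X i) (X i) F) (y z : ∀ i, X i) :
    piKronecker X F m y z = ∏ i, m i (y i) (z i) := rfl

theorem piKronecker_one [CommRing F] [∀ i, DecidableEq (X i)] [DecidableEq (∀ i, X i)] :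
    piKronecker X F 1 = 1 := by
  ext y z
  simp [piKronecker_apply, Matrix.one_apply, Finset.prod_ite_zero, funext_iff]

theorem piKronecker_mul [CommRing F] [DecidableEq ι] [∀ i, Fintype (X i)]
    (m m' : ∀ i, Matrix (X i) (X i) F) :
    piKronecker X F (m * m') = piKronecker X F m * piKronecker X F m' := by
  ext y z
  simp only [piKronecker_apply, Matrix.mul_apply, Pi.mul_apply, ← Finset.prod_mul_distrib]
  rw [Finset.prod_univ_sum, Fintype.piFinset_univ]

/-- A product of linear functionals is a linear functional of the Kronecker product: it is determined
by its values on the matrix units of the product. -/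
theorem exists_functional_piKronecker [CommRing F] [DecidableEq ι] [∀ i, Fintype (X i)]
    [∀ i, DecidableEq (X i)] (g : ∀ i, Matrix (X i) (X i) F →ₗ[F] F) :
    ∃ G : Matrix (∀ i, X i) (∀ i, X i) F →ₗ[F] F, ∀ m, G (piKronecker X F m) = ∏ i, g i (m i) := by
  refine ⟨∑ y : ∀ i, X i, ∑ z : ∀ i, X i, (∏ i, g i (Matrix.single (y i) (z i) 1)) •
    Matrix.entryLinearMap F F y z, fun m => ?_⟩
  have hg : ∀ i, g i (m i) =
      ∑ y, ∑ z, g i (Matrix.single y z 1) * m i y z := fun i => by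
    conv_lhs => rw [Matrix.matrix_eq_sum_single (m i)]
    simp only [map_sum]
    refine Finset.sum_congr rfl fun y _ => Finset.sum_congr rfl fun z _ => ?_
    rw [← mul_one (m i y z), ← smul_eq_mul, ← Matrix.smul_single, map_smul]
    simp [mul_comm]
  simp only [hg, Finset.prod_univ_sum, Fintype.piFinset_univ]
  simp [LinearMap.sum_apply, piKronecker_apply, Finset.prod_mul_distrib]

end Matrix
end PiKronecker

namespace AssocScheme

open Matrix

section

variable (F : Type w) [Field F] {X : Type u} {E : Type v} [Fintype X] [DecidableEq X] [Nonempty X]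
  [Fintype E]

theorem adjacency_zero (S : AssocScheme X E) : S.adjacency F S.zero = 1 := by
  ext y z
  simp [adjacency, S.R_zero, Matrix.one_apply]

theorem sum_dualIdempotent (S : AssocScheme X E) (x : X) : ∑ g, S.dualIdempotent F x g = 1 := by
  classical
  ext y z
  rw [Matrix.sum_apply, Matrix.one_apply]
  by_cases h : y = z
  · subst h
    obtain ⟨a, ha, hu⟩ := S.R_partition (x, y)
    rw [Finset.sum_eq_single a]
    · simp [dualIdempotent, ha]
    · intro b _ hb
      have : (x, y) ∉ S.R b := fun h => hb (hu b h)
      simp [dualIdempotent, this]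
    · simp
  · simp [dualIdempotent, h]

end

section DirectProduct

variable (F : Type w) [Field F] {n : ℕ} {X : Fin n → Type u} {E : Fin n → Type v}
  [∀ h, Fintype (X h)] [∀ h, Nonempty (X h)] [∀ h, Fintype (E h)]
  (S : ∀ h, AssocScheme (X h) (E h))

theorem adjacency_directProduct (g : ∀ h, E h) :
    (directProduct S).adjacency F g = piKronecker X F fun h => (S h).adjacency F (g h) := by
  classical
  ext y z
  simp only [adjacency, directProduct, piKronecker_apply, Matrix.of_apply, Set.mem_ofPred_eq,
    Finset.prod_ite_zero, Finset.mem_univ, true_imp_iff, Finset.prod_const_one]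
  congr

variable [∀ h, DecidableEq (X h)] (x : ∀ h, X h)

theorem dualIdempotent_directProduct (g : ∀ h, E h) :
    (directProduct S).dualIdempotent F x g =
      piKronecker X F fun h => (S h).dualIdempotent F (x h) (g h) := by
  classical
  ext y z
  simp only [dualIdempotent, directProduct, piKronecker_apply, Matrix.diagonal_apply,
    Set.mem_ofPred_eq, ← ite_and, Finset.prod_ite_zero, funext_iff, forall_and, Finset.mem_univ,
    true_imp_iff, Finset.prod_const_one]
  rw [ite_and]
  congr

/-- The Terwilliger algebra of a direct product contains those of the factors, each acting on its own
coordinate and trivially on all others. -/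
theorem piKronecker_mulSingle_mem (i : Fin n) {M : Matrix (X i) (X i) F}
    (hM : M ∈ (S i).terwilligerAlgebra F (x i)) :
    piKronecker X F (Pi.mulSingle i M) ∈ (directProduct S).terwilligerAlgebra F x := by
  induction hM using Algebra.adjoin_induction with
  | mem N hN =>
    obtain ⟨g, rfl⟩ | ⟨g, rfl⟩ := hN
    · have : piKronecker X F (Pi.mulSingle i ((S i).adjacency F g)) =
          (directProduct S).adjacency F (Function.update (fun h => (S h).zero) i g) := by
        rw [adjacency_directProduct]
        congr 1
        ext1 h
        obtain rfl | hh := eq_or_ne h i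
        · simp
        · simp [hh, adjacency_zero]
      rw [this]
      exact Algebra.subset_adjoin (Or.inl ⟨_, rfl⟩)
    · have : piKronecker X F (Pi.mulSingle i ((S i).dualIdempotent F (x i) g)) =
          ∑ a ∈ Fintype.piFinset (Function.update (fun _ => Finset.univ) i {g}),
            (directProduct S).dualIdempotent F x a := by
        simp only [dualIdempotent_directProduct]
        rw [← MultilinearMap.map_sum_finset (piKronecker X F)
          (fun h g => (S h).dualIdempotent F (x h) g)]
        congr 1
        ext1 h
        obtain rfl | hh := eq_or_ne h i
        · simp
        · simp [hh, sum_dualIdempotent]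
      rw [this]
      exact sum_mem fun a _ => Algebra.subset_adjoin (Or.inr ⟨_, rfl⟩)
  | algebraMap r =>
    rw [Algebra.algebraMap_eq_smul_one, Pi.mulSingle, MultilinearMap.map_update_smul]
    change r • piKronecker X F (Pi.mulSingle i 1) ∈ _
    rw [Pi.mulSingle_one, piKronecker_one]
    exact Subalgebra.smul_mem _ (one_mem _) r
  | add A B _ _ hA hB =>
    rw [Pi.mulSingle, MultilinearMap.map_update_add]
    exact add_mem hA hB
  | mul A B _ _ hA hB =>
    rw [Pi.mulSingle_mul, piKronecker_mul]
    exact mul_mem hA hB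

theorem piKronecker_mem {m : ∀ h, Matrix (X h) (X h) F}
    (hm : ∀ h, m h ∈ (S h).terwilligerAlgebra F (x h)) :
    piKronecker X F m ∈ (directProduct S).terwilligerAlgebra F x := by
  have key : ∀ s : Finset (Fin n),
      piKronecker X F (s.piecewise m 1) ∈ (directProduct S).terwilligerAlgebra F x := by
    intro s
    induction s using Finset.induction with
    | empty => simp [piKronecker_one, one_mem]
    | insert i s hi ih =>
      have : (insert i s).piecewise m (1 : ∀ h, Matrix (X h) (X h) F) =
          Pi.mulSingle i (m i) * s.piecewise m (1 : ∀ h, Matrix (X h) (X h) F) := by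
        ext1 h
        obtain rfl | hh := eq_or_ne h i
        · simp [hi]
        · by_cases hs : h ∈ s <;> simp [hh, hs]
      rw [this, piKronecker_mul]
      exact mul_mem (piKronecker_mulSingle_mem F S x i (hm i)) ih
  simpa using key Finset.univ

theorem terwilligerAlgebra_le_span :
    ((directProduct S).terwilligerAlgebra F x).toSubmodule ≤
      Submodule.span F {M | ∃ m : ∀ h, Matrix (X h) (X h) F,
        (∀ h, m h ∈ (S h).terwilligerAlgebra F (x h)) ∧ piKronecker X F m = M} := by
  intro M hM
  induction hM using Algebra.adjoin_induction with
  | mem N hN =>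
    obtain ⟨g, rfl⟩ | ⟨g, rfl⟩ := hN
    · exact Submodule.subset_span ⟨_, fun h => Algebra.subset_adjoin (Or.inl ⟨g h, rfl⟩),
        (adjacency_directProduct F S g).symm⟩
    · exact Submodule.subset_span ⟨_, fun h => Algebra.subset_adjoin (Or.inr ⟨g h, rfl⟩),
        (dualIdempotent_directProduct F S x g).symm⟩
  | algebraMap r =>
    rw [Algebra.algebraMap_eq_smul_one]
    exact Submodule.smul_mem _ _ (Submodule.subset_span ⟨1, fun h => one_mem _, piKronecker_one⟩)
  | add A B _ _ hA hB => exact add_mem hA hB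
  | mul A B _ _ hA hB =>
    have := Submodule.mul_mem_mul hA hB
    rw [Submodule.span_mul_span] at this
    refine Submodule.span_mono ?_ this
    rintro _ ⟨_, ⟨m, hm, rfl⟩, _, ⟨m', hm', rfl⟩, rfl⟩
    exact ⟨m * m', fun h => mul_mem (hm h) (hm' h), piKronecker_mul m m'⟩

/-- The Kronecker product of elements of the Terwilliger algebras of the factors, as an element of the
Terwilliger algebra of the direct product. -/
noncomputable def terwilligerTensor :
    MultilinearMap F (fun h => (S h).terwilligerAlgebra F (x h))
      ((directProduct S).terwilligerAlgebra F x) :=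
  ((piKronecker X F).compLinearMap fun h =>
      ((S h).terwilligerAlgebra F (x h)).val.toLinearMap).codRestrict
    ((directProduct S).terwilligerAlgebra F x).toSubmodule
    fun m => piKronecker_mem F S x fun h => (m h).2

theorem isTensorDecomposition_terwilligerTensor :
    IsTensorDecomposition (terwilligerTensor F S x) where
  apply_one := Subtype.ext piKronecker_one
  apply_mul m m' := Subtype.ext (piKronecker_mul _ _)
  span_range := by
    refine Submodule.map_injective_of_injective (f := ((directProduct S).terwilligerAlgebra F
      x).val.toLinearMap) Subtype.val_injective (le_antisymm (Submodule.map_mono le_top) ?_)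
    rintro _ ⟨M, -, rfl⟩
    rw [Submodule.map_span, ← Set.range_comp]
    refine Submodule.span_mono ?_ (terwilligerAlgebra_le_span F S x M.2)
    rintro _ ⟨m, hm, rfl⟩
    exact ⟨fun h => ⟨m h, hm h⟩, rfl⟩
  exists_functional g := by
    choose g' hg' using fun h => LinearMap.exists_extend
      (p := ((S h).terwilligerAlgebra F (x h)).toSubmodule) (g h)
    obtain ⟨G, hG⟩ := exists_functional_piKronecker g'
    refine ⟨G ∘ₗ ((directProduct S).terwilligerAlgebra F x).val.toLinearMap, fun m => ?_⟩
    refine (hG _).trans (Finset.prod_congr rfl fun h _ => ?_)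
    exact LinearMap.congr_fun (hg' h) (m h)

end DirectProduct
end AssocScheme

/-! ### The Terwilliger algebra of a trivial scheme -/

namespace TrivialScheme

open AssocScheme Matrix

variable {F : Type w} [Field F] {V : Type u} [DecidableEq V]

/-- The matrix with entries `α` at `(x, x)`, `β` in the rest of row `x`, `γ` in the rest of column `x`,
and the block `δ I + ε J` on the complement of `x`. If `|V| = 2`, that block only determines
`δ + ε`. -/
def pointed (x : V) (α β γ δ ε : F) : Matrix V V F :=
  Matrix.of fun y z =>
    if y = x then (if z = x then α else β) else if z = x then γ else (if y = z then δ else 0) + ε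

theorem pointed_add (x : V) (α β γ δ ε α' β' γ' δ' ε' : F) :
    pointed x α β γ δ ε + pointed x α' β' γ' δ' ε' =
      pointed x (α + α') (β + β') (γ + γ') (δ + δ') (ε + ε') := by
  ext y z
  simp only [pointed, Matrix.add_apply, Matrix.of_apply]
  split_ifs <;> ring

theorem smul_pointed (x : V) (r α β γ δ ε : F) :
    r • pointed x α β γ δ ε = pointed x (r * α) (r * β) (r * γ) (r * δ) (r * ε) := by
  ext y z
  simp only [pointed, Matrix.smul_apply, Matrix.of_apply, smul_eq_mul]
  split_ifs <;> ring

theorem one_eq_pointed (x : V) : (1 : Matrix V V F) = pointed x 1 0 0 1 0 := by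
  ext y z
  simp only [pointed, Matrix.one_apply, Matrix.of_apply]
  split_ifs <;> simp_all

theorem cast_card_pred {R V : Type*} [Ring R] [Fintype V] [Nonempty V] :
    ((Fintype.card V - 1 : ℕ) : R) = Fintype.card V - 1 :=
  Nat.cast_pred Fintype.card_pos

variable [Fintype V]

theorem pointed_mul (x : V) (α β γ δ ε α' β' γ' δ' ε' : F) :
    pointed x α β γ δ ε * pointed x α' β' γ' δ' ε' =
      pointed x (α * α' + (Fintype.card V - 1) * (β * γ'))
        (α * β' + β * (δ' + (Fintype.card V - 1) * ε'))
        (γ * α' + (δ + (Fintype.card V - 1) * ε) * γ')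
        (δ * δ') (γ * β' + δ * ε' + ε * δ' + (Fintype.card V - 1) * (ε * ε')) := by
  have hcard : ((Fintype.card V - 1 : ℕ) : F) = Fintype.card V - 1 :=
    have : Nonempty V := ⟨x⟩
    cast_card_pred
  ext y z
  rw [Matrix.mul_apply, ← Finset.add_sum_erase _ _ (Finset.mem_univ x)]
  have hsum : ∀ t ∈ Finset.univ.erase x,
      pointed x α β γ δ ε y t * pointed x α' β' γ' δ' ε' t z =
        (if y = x then β else (if y = t then δ else 0) + ε) *
          (if z = x then γ' else (if t = z then δ' else 0) + ε') := by
    intro t ht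
    simp [pointed, Finset.ne_of_mem_erase ht]
  rw [Finset.sum_congr rfl hsum]
  by_cases hy : y = x <;> by_cases hz : z = x
  · simp [pointed, hy, hz, hcard]
  · simp [pointed, hy, hz, hcard, mul_add, Finset.sum_add_distrib]
    ring
  · simp [pointed, hy, hz, hcard, add_mul, Finset.sum_add_distrib]
    ring
  · simp [pointed, hy, hz, hcard, add_mul, mul_add, Finset.sum_add_distrib]
    split_ifs <;> ring

variable (V) in
/-- The simple blocks of the Terwilliger algebra of the trivial scheme on `V`: `false` stands for the
action on vectors constant off the base point, `true` for the action on differences of two points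
other than the base point, which exists only if `|V| > 2`. -/
abbrev Block : Type := {k : Bool // k = true → 2 < Fintype.card V}

/-- The rows of the block `k`. Row `0` belongs to the base point and row `1` to its complement: the block
`true` only has row `1`, and in the block `false` row `1` disappears if `p ∣ |V| - 1`. -/
abbrev BlockIndex (p : ℕ) (k : Block V) : Type :=
  {a : Fin 2 // (k.1 = true → a = 1) ∧ (k.1 = false → p ∣ Fintype.card V - 1 → a = 0)}

/-- The entry at `(a, c)` in the block `k`, for `v ≠ x` and a third point `w`. For the block `false` it
is the sum of the entries over the column class `c`, in the row of a representative of the class `a`;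
for the block `true` it does not depend on `a` and `c`. -/
def blockEntry (x v w : V) (k : Bool) (a c : Fin 2) : Matrix V V F →ₗ[F] F :=
  match k with
  | true => Matrix.entryLinearMap F F v v - Matrix.entryLinearMap F F v w
  | false => ∑ z with (z = x ↔ c = 0), Matrix.entryLinearMap F F (if a = 0 then x else v) z

theorem blockEntry_true_pointed {x v w : V} (hv : v ≠ x) (hw : w ≠ x) (hvw : v ≠ w)
    (a c : Fin 2) (α β γ δ ε : F) :
    blockEntry x v w true a c (pointed x α β γ δ ε) = δ := by
  simp [blockEntry, pointed, hv, hw, hvw]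

theorem blockEntry_false_pointed {x v : V} (hv : v ≠ x) (w : V) (a c : Fin 2)
    (α β γ δ ε : F) :
    blockEntry x v w false a c (pointed x α β γ δ ε) =
      !![α, (Fintype.card V - 1) * β; γ, δ + (Fintype.card V - 1) * ε] a c := by
  have hcard : ((Fintype.card V - 1 : ℕ) : F) = Fintype.card V - 1 :=
    have : Nonempty V := ⟨x⟩
    cast_card_pred
  have h1 : (Finset.univ.filter fun z : V => z ≠ x) = Finset.univ.erase x := by
    ext; simp
  have hne : ∀ y, ∀ z ∈ Finset.univ.erase x, pointed x α β γ δ ε y z =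
      if y = x then β else (if y = z then δ else 0) + ε := by
    intro y z hz
    simp [pointed, Finset.ne_of_mem_erase hz]
  obtain rfl | rfl : c = 0 ∨ c = 1 := by fin_cases c <;> simp
  · simp only [blockEntry, iff_true, Finset.filter_eq', Finset.mem_univ, if_true,
      Finset.sum_singleton, Matrix.entryLinearMap_apply]
    fin_cases a <;> simp [pointed, hv]
  · simp only [blockEntry, one_ne_zero, iff_false, ← ne_eq, h1, LinearMap.sum_apply,
      Matrix.entryLinearMap_apply]
    rw [Finset.sum_congr rfl (hne _)]
    fin_cases a <;> simp [hv, hcard, Finset.sum_add_distrib]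

variable [Nontrivial V]

theorem adjacency_one_eq_pointed (x : V) :
    (trivialScheme V).adjacency F 1 = pointed x 0 1 1 (-1) 1 := by
  ext y z
  simp only [pointed, adjacency, trivialScheme, Matrix.of_apply, Set.mem_ofPred_eq, one_ne_zero,
    iff_false]
  split_ifs <;> simp_all

theorem dualIdempotent_zero_eq_pointed (x : V) :
    (trivialScheme V).dualIdempotent F x 0 = pointed x 1 0 0 0 0 := by
  ext y z
  simp only [pointed, dualIdempotent, trivialScheme, Matrix.of_apply, Set.mem_ofPred_eq, iff_true,
    Matrix.diagonal_apply, eq_comm (a := x)]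
  split_ifs <;> simp_all

theorem dualIdempotent_one_eq_pointed (x : V) :
    (trivialScheme V).dualIdempotent F x 1 = pointed x 0 0 0 1 0 := by
  ext y z
  simp only [pointed, dualIdempotent, trivialScheme, Matrix.of_apply, Set.mem_ofPred_eq,
    Matrix.diagonal_apply, one_ne_zero, iff_false, eq_comm (a := x)]
  split_ifs <;> simp_all

theorem mem_terwilligerAlgebra_iff (x : V) (M : Matrix V V F) :
    M ∈ (trivialScheme V).terwilligerAlgebra F x ↔
      ∃ α β γ δ ε : F, M = pointed x α β γ δ ε := by
  constructor
  · intro hM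
    induction hM using Algebra.adjoin_induction with
    | mem N hN =>
      obtain ⟨g, rfl⟩ | ⟨g, rfl⟩ := hN <;> fin_cases g
      · exact ⟨_, _, _, _, _, (adjacency_zero F _).trans (one_eq_pointed x)⟩
      · exact ⟨_, _, _, _, _, adjacency_one_eq_pointed x⟩
      · exact ⟨_, _, _, _, _, dualIdempotent_zero_eq_pointed x⟩
      · exact ⟨_, _, _, _, _, dualIdempotent_one_eq_pointed x⟩
    | algebraMap r =>
      rw [Algebra.algebraMap_eq_smul_one, one_eq_pointed x, smul_pointed]
      exact ⟨_, _, _, _, _, rfl⟩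
    | add A B _ _ hA hB =>
      obtain ⟨α, β, γ, δ, ε, rfl⟩ := hA
      obtain ⟨α', β', γ', δ', ε', rfl⟩ := hB
      exact ⟨_, _, _, _, _, pointed_add ..⟩
    | mul A B _ _ hA hB =>
      obtain ⟨α, β, γ, δ, ε, rfl⟩ := hA
      obtain ⟨α', β', γ', δ', ε', rfl⟩ := hB
      exact ⟨_, _, _, _, _, pointed_mul ..⟩
  · rintro ⟨α, β, γ, δ, ε, rfl⟩
    have h0 : pointed x 1 0 0 0 0 ∈ (trivialScheme V).terwilligerAlgebra F x :=
      dualIdempotent_zero_eq_pointed (F := F) x ▸ Algebra.subset_adjoin (Or.inr ⟨0, rfl⟩)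
    have h1 : pointed x 0 0 0 1 0 ∈ (trivialScheme V).terwilligerAlgebra F x :=
      dualIdempotent_one_eq_pointed (F := F) x ▸ Algebra.subset_adjoin (Or.inr ⟨1, rfl⟩)
    have hA : pointed x 0 1 1 (-1) 1 ∈ (trivialScheme V).terwilligerAlgebra F x :=
      adjacency_one_eq_pointed (F := F) x ▸ Algebra.subset_adjoin (Or.inl ⟨1, rfl⟩)
    -- The products `E*_a A_1 E*_c` are the blocks of `A_1 = J - I`.
    have h01 := mul_mem (mul_mem h0 hA) h1
    have h10 := mul_mem (mul_mem h1 hA) h0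
    have h11 := mul_mem (mul_mem h1 hA) h1
    have := add_mem (add_mem (add_mem (add_mem (Subalgebra.smul_mem _ h0 α)
      (Subalgebra.smul_mem _ h01 β)) (Subalgebra.smul_mem _ h10 γ))
      (Subalgebra.smul_mem _ h1 (δ + ε))) (Subalgebra.smul_mem _ h11 ε)
    simp only [pointed_mul, smul_pointed, pointed_add] at this
    convert! this using 2 <;> ring

/-- The Terwilliger algebra of a trivial scheme maps onto a product of matrix algebras, and products of
three elements of the kernel vanish. -/
theorem exists_algHom_blocks (p : ℕ) [CharP F p] (x : V) :
    ∃ ψ : (trivialScheme V).terwilligerAlgebra F x →ₐ[F]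
        ∀ k : Block V, Matrix (BlockIndex p k) (BlockIndex p k) F,
      Function.Surjective ψ ∧
        ∀ a b c, ψ a = 0 → ψ b = 0 → ψ c = 0 → a * b * c = 0 := by
  have hcard2 : 2 ≤ Fintype.card V := Fintype.one_lt_card
  have hp : p ∣ Fintype.card V - 1 ↔ (Fintype.card V - 1 : F) = 0 := by
    rw [← CharP.cast_eq_zero_iff F p, cast_card_pred]
  obtain ⟨v, hv⟩ := exists_ne x
  -- If `|V| = 2`, there is no third point; then the block `true` is empty and `w` is irrelevant.
  obtain ⟨w, hw⟩ : ∃ w, 2 < Fintype.card V → w ≠ x ∧ v ≠ w := by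
    by_cases h : 2 < Fintype.card V
    · obtain ⟨w, hw⟩ : ∃ w, w ∉ ({x, v} : Finset V) := by
        by_contra! hall
        have := Finset.card_le_card fun w (_ : w ∈ Finset.univ) => hall w
        rw [Finset.card_univ, Finset.card_pair hv.symm] at this
        omega
      simp only [Finset.mem_insert, Finset.mem_singleton, not_or] at hw
      exact ⟨w, fun _ => ⟨hw.1, Ne.symm hw.2⟩⟩
    · exact ⟨x, fun h' => absurd h' h⟩
  let L : (trivialScheme V).terwilligerAlgebra F x →ₗ[F]
      ∀ k : Block V, Matrix (BlockIndex p k) (BlockIndex p k) F :=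
    { toFun := fun M k => Matrix.of fun a c => blockEntry x v w k.1 a.1 c.1 M.1
      map_add' := fun M M' => by ext; simp
      map_smul' := fun r M => by ext; simp }
  have hL : ∀ M k a c, L M k a c = blockEntry x v w k.1 a.1 c.1 M.1 := fun _ _ _ _ => rfl
  have hmul : ∀ M M', L (M * M') = L M * L M' := by
    rintro ⟨M, hM⟩ ⟨M', hM'⟩
    obtain ⟨α, β, γ, δ, ε, rfl⟩ := (mem_terwilligerAlgebra_iff x M).1 hM
    obtain ⟨α', β', γ', δ', ε', rfl⟩ := (mem_terwilligerAlgebra_iff x M').1 hM'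
    ext ⟨k, hk⟩ ⟨a, ha⟩ ⟨c, hc⟩
    rw [Pi.mul_apply, Matrix.mul_apply]
    simp only [hL, MulMemClass.mk_mul_mk, pointed_mul]
    rw [← Finset.sum_subtype (Finset.univ.filter fun a : Fin 2 => (k = true → a = 1) ∧
        (k = false → p ∣ Fintype.card V - 1 → a = 0)) (by simp)
      (fun b => blockEntry x v w k a b (pointed x α β γ δ ε) *
        blockEntry x v w k b c (pointed x α' β' γ' δ' ε'))]
    -- If `p ∣ |V| - 1`, the summand for the missing row `1` is a multiple of `|V| - 1`, hence zero.
    cases k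
    · simp only [blockEntry_false_pointed hv]
      rw [Finset.sum_filter, Fin.sum_univ_two]
      by_cases hd : p ∣ Fintype.card V - 1
      · rw [ha.2 rfl hd, hc.2 rfl hd]
        simp [hd, hp.1 hd]
      · fin_cases a <;> fin_cases c <;> simp [hd] <;> ring
    · obtain ⟨hwx, hvw⟩ := hw (hk rfl)
      simp only [blockEntry_true_pointed hv hwx hvw]
      rw [Finset.sum_filter, Fin.sum_univ_two]
      simp
  have hone : L 1 = 1 := by
    ext ⟨k, hk⟩ ⟨a, ha⟩ ⟨c, hc⟩
    rw [hL, Pi.one_apply, Matrix.one_apply, OneMemClass.coe_one, one_eq_pointed x]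
    cases k
    · simp only [blockEntry_false_pointed hv]
      fin_cases a <;> fin_cases c <;> simp
    · obtain ⟨hwx, hvw⟩ := hw (hk rfl)
      simp only [blockEntry_true_pointed hv hwx hvw]
      simp [ha.1 rfl, hc.1 rfl]
  refine ⟨AlgHom.ofLinearMap L hone hmul, fun T => ?_, ?_⟩
  · obtain ⟨t, ht⟩ : ∃ t : Bool → Fin 2 → Fin 2 → F, ∀ k a c, T k a c = t k.1 a.1 c.1 := by
      classical
      refine ⟨fun k a c => if hk : k = true → 2 < Fintype.card V then
        if ha : (k = true → a = 1) ∧ (k = false → p ∣ Fintype.card V - 1 → a = 0) then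
        if hc : (k = true → c = 1) ∧ (k = false → p ∣ Fintype.card V - 1 → c = 0) then
          T ⟨k, hk⟩ ⟨a, ha⟩ ⟨c, hc⟩ else 0 else 0 else 0, fun k a c => ?_⟩
      exact ((dif_pos k.2).trans ((dif_pos a.2).trans (dif_pos c.2))).symm
    -- If `|V| - 1 = 0` in `F`, both quotients below are `0`, and the rows they would be needed for
    -- are missing. If `|V| = 2`, any `δ` works, as only `δ + ε` matters.
    let δ : F := if 2 < Fintype.card V then t true 1 1 else 0
    refine ⟨⟨pointed x (t false 0 0) (t false 0 1 / (Fintype.card V - 1)) (t false 1 0) δ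
      ((t false 1 1 - δ) / (Fintype.card V - 1)), (mem_terwilligerAlgebra_iff x _).2
        ⟨_, _, _, _, _, rfl⟩⟩, ?_⟩
    ext ⟨k, hk⟩ ⟨a, ha⟩ ⟨c, hc⟩
    rw [ht]
    refine (hL _ _ _ _).trans ?_
    cases k
    · simp only [blockEntry_false_pointed hv]
      simp only [true_imp_iff, hp, reduceCtorEq, false_imp_iff, true_and] at ha hc
      by_cases hN : (Fintype.card V - 1 : F) = 0
      · simp [ha hN, hc hN]
      · fin_cases a <;> fin_cases c <;> simp [mul_div_cancel₀, hN]
    · obtain ⟨hwx, hvw⟩ := hw (hk rfl)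
      simp only [blockEntry_true_pointed hv hwx hvw]
      simp [δ, hk rfl, ha.1 rfl, hc.1 rfl]
  · -- The kernel is zero if `|V| - 1 ≠ 0` in `F`, and has `α = δ = 0` otherwise.
    have hker : ∀ M, L M = 0 → ∃ β γ ε : F, M.1 = pointed x 0 β γ 0 ε ∧
        ((Fintype.card V - 1 : F) ≠ 0 → M = 0) := by
      rintro ⟨M, hM⟩ h
      obtain ⟨α, β, γ, δ, ε, rfl⟩ := (mem_terwilligerAlgebra_iff x M).1 hM
      have h0 : ∀ (k : Block V) (a c : BlockIndex p k),
          blockEntry x v w k.1 a.1 c.1 (pointed x α β γ δ ε) = 0 := fun k a c => by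
        rw [← hL ⟨_, hM⟩ k a c, h]; rfl
      have hf : ∀ a c : Fin 2, (p ∣ Fintype.card V - 1 → a = 0 ∧ c = 0) →
          !![α, (Fintype.card V - 1) * β; γ, δ + (Fintype.card V - 1) * ε] a c = 0 :=
        fun a c hac => by
          rw [← blockEntry_false_pointed hv w]
          exact h0 ⟨false, by simp⟩ ⟨a, by simp, fun _ hd => (hac hd).1⟩
            ⟨c, by simp, fun _ hd => (hac hd).2⟩
      have ht : 2 < Fintype.card V → δ = 0 := fun hV => by
        obtain ⟨hwx, hvw⟩ := hw hV
        rw [← blockEntry_true_pointed hv hwx hvw 1 1 α β γ δ ε]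
        exact h0 ⟨true, fun _ => hV⟩ ⟨1, by simp⟩ ⟨1, by simp⟩
      have hα : α = 0 := by simpa using hf 0 0 (by simp)
      by_cases hd : p ∣ Fintype.card V - 1
      · have hN := hp.1 hd
        -- If `|V| = 2`, then `|V| - 1 = 1` is nonzero, so here `|V| > 2` and the block `true` exists.
        have hδ : δ = 0 := ht (by
          by_contra hV
          rw [show Fintype.card V = 2 by omega] at hN
          norm_num at hN)
        exact ⟨β, γ, ε, by subst hα hδ; rfl, fun h => absurd hN h⟩
      · have hN : (Fintype.card V - 1 : F) ≠ 0 := fun h => hd (hp.2 h)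
        have hβ : β = 0 := by simpa [hN] using hf 0 1 (fun h => absurd h hd)
        have hγ : γ = 0 := by simpa using hf 1 0 (fun h => absurd h hd)
        have hε : δ + (Fintype.card V - 1) * ε = 0 := by
          simpa using hf 1 1 (fun h => absurd h hd)
        have hM0 : pointed x α β γ δ ε = 0 := by
          subst hα hβ hγ
          by_cases hV : 2 < Fintype.card V
          · obtain rfl := ht hV
            obtain rfl : ε = 0 := by simpa [hN] using hε
            ext y z
            simp [pointed]
          · rw [show Fintype.card V = 2 by omega] at hε
            -- Only one point differs from `x`, so the last block of the matrix is `δ + ε = 0`.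
            have hyz : ∀ y z, y ≠ x → z ≠ x → y = z := fun y z hy hz => by
              by_contra hne
              have := Finset.card_le_univ {x, y, z}
              rw [Finset.card_eq_three.2 ⟨x, y, z, hy.symm, hz.symm, hne, rfl⟩] at this
              exact hV this
            ext y z
            by_cases hy : y = x <;> by_cases hz : z = x
            all_goals simp [pointed, hy, hz]
            rw [if_pos (hyz y z hy hz)]
            linear_combination hε
        exact ⟨0, 0, 0, hM0.trans (by ext; simp [pointed]), fun _ => Subtype.ext hM0⟩
    rintro a b c ha hb hc
    obtain ⟨β, γ, ε, haM, ha0⟩ := hker a ha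
    obtain ⟨β', γ', ε', hbM, -⟩ := hker b hb
    obtain ⟨β'', γ'', ε'', hcM, -⟩ := hker c hc
    by_cases hN : (Fintype.card V - 1 : F) = 0
    · apply Subtype.ext
      rw [MulMemClass.coe_mul, MulMemClass.coe_mul, haM, hbM, hcM, pointed_mul, pointed_mul, hN]
      ext
      simp [pointed]
    · rw [ha0 hN, zero_mul, zero_mul]

end TrivialScheme

/-! ### Classes of triples and blocks -/

namespace Factorial

open AssocScheme TrivialScheme

variable {n : ℕ} (U : Fin n → Type u) [∀ i, Fintype (U i)] [∀ i, Nontrivial (U i)] (p : ℕ)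

theorem valency_scheme (b : Fin n → Fin 2) :
    (scheme U).valency b = ∏ i, if b i = 1 then Fintype.card (U i) - 1 else 1 := by
  classical
  let x : ∀ i, U i := fun i => Classical.arbitrary (U i)
  rw [valency_eq _ _ x, ← Nat.card_coe_set_eq]
  refine (Nat.card_congr (Equiv.subtypePiEquivPi (p := fun i a => (x i, a) ∈
    (trivialScheme (U i)).R (b i)))).trans ?_
  rw [Nat.card_pi]
  refine Finset.prod_congr rfl fun i _ => ?_
  rw [Nat.card_eq_fintype_card, Fintype.card_subtype]
  obtain hb | hb : b i = 0 ∨ b i = 1 := by omega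
  · simp [trivialScheme, hb, Finset.filter_eq]
  · simp only [trivialScheme, hb, Set.mem_ofPred_eq, one_ne_zero, iff_false, if_true]
    rw [← Finset.card_univ, ← Finset.card_erase_of_mem (Finset.mem_univ (x i))]
    congr 1
    ext a
    simp [eq_comm]

theorem dvd_valency_scheme_iff (F : Type w) [Field F] [CharP F p] (b : Fin n → Fin 2) :
    p ∣ (scheme U).valency b ↔ ∃ i, b i = 1 ∧ p ∣ Fintype.card (U i) - 1 := by
  rw [valency_scheme, ← CharP.cast_eq_zero_iff F p, Nat.cast_prod, Finset.prod_eq_zero_iff]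
  simp only [Finset.mem_univ, true_and, ← CharP.cast_eq_zero_iff F p]
  refine exists_congr fun i => ?_
  by_cases hb : b i = 1 <;> simp [hb]

variable {U p}

/-- The set `(a ∩ c)° \ b` of a triple `(a, b, c)`, which determines its class. -/
def classSet (t : regularTriples U p) : Finset (Fin n) :=
  big U (supp t.1.1 ∩ supp t.1.2.2) \ supp t.1.2.1

theorem two_lt_card_of_mem_classSet {t : regularTriples U p} {i : Fin n} (hi : i ∈ classSet t) :
    2 < Fintype.card (U i) := by
  simp only [classSet, big, Finset.mem_sdiff, Finset.mem_filter] at hi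
  exact hi.1.2

/-- The class of triples with `(a ∩ c)° \ b = W`, as a choice of blocks: the block `true` exactly at the
coordinates in `W`. -/
def blockOfClass (m : Classes U p) : ∀ i, Block (U i) :=
  Quotient.lift (fun t i => (⟨decide (i ∈ classSet t), fun h =>
    two_lt_card_of_mem_classSet (of_decide_eq_true h)⟩ : Block (U i)))
    (fun t t' (h : classSet t = classSet t') => by simp only [h]) m

theorem coe_blockOfClass_mk (t : regularTriples U p) (i : Fin n) :
    (blockOfClass (Quotient.mk (tripleSetoid U p) t) i).1 = decide (i ∈ classSet t) := rfl

theorem bijective_blockOfClass (F : Type w) [Field F] [CharP F p] :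
    Function.Bijective (blockOfClass : Classes U p → ∀ i, Block (U i)) := by
  constructor
  · intro m m'
    induction m, m' using Quotient.inductionOn₂ with | _ t t'
    intro h
    refine Quotient.sound (show classSet t = classSet t' from ?_)
    ext i
    have := congrArg Subtype.val (congrFun h i)
    simpa [coe_blockOfClass_mk] using this
  · intro k
    let a : Fin n → Fin 2 := fun i => if (k i).1 = true then 1 else 0
    have ha : ((a, 0, a) : (Fin n → Fin 2) × (Fin n → Fin 2) × (Fin n → Fin 2)) ∈
        regularTriples U p := by
      refine ⟨⟨by simp, by simp [supp]⟩, ?_⟩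
      rw [dvd_valency_scheme_iff U p F]
      simp
    refine ⟨Quotient.mk _ ⟨_, ha⟩, ?_⟩
    ext1 i
    apply Subtype.ext
    rw [coe_blockOfClass_mk]
    have hk := (k i).2
    by_cases h : (k i).1 = true
    · simp [classSet, supp, big, a, h, hk h]
    · simp [classSet, supp, big, a, h]

/-- The diagonal indices of a class are the tuples of rows of the blocks chosen by the class. -/
theorem mem_diagIndices_iff (F : Type w) [Field F] [CharP F p] (m : Classes U p)
    (a : Fin n → Fin 2) : a ∈ diagIndices U p m ↔
      ∀ i, ((blockOfClass m i).1 = true → a i = 1) ∧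
        ((blockOfClass m i).1 = false → p ∣ Fintype.card (U i) - 1 → a i = 0) := by
  induction m using Quotient.inductionOn with | _ t
  simp only [coe_blockOfClass_mk, decide_eq_true_eq, decide_eq_false_iff_not]
  constructor
  · rintro ⟨b, h, hm⟩
    have hset : classSet ⟨(a, b, a), h⟩ = classSet t := Quotient.exact hm
    have hval := h.2
    rw [dvd_valency_scheme_iff U p F] at hval
    intro i
    rw [← hset]
    simp only [classSet, big, supp, Finset.inter_self, Finset.mem_sdiff, Finset.mem_filter,
      Finset.mem_univ, true_and]
    refine ⟨fun h => h.1.1, fun h hd => ?_⟩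
    by_contra ha
    have ha1 : a i = 1 := by omega
    -- `p ∣ |U i| - 1` excludes `|U i| = 2`, as `p ≠ 1`.
    have hcard : 2 < Fintype.card (U i) := by
      by_contra hc
      have h1 : 1 < Fintype.card (U i) := Fintype.one_lt_card
      rw [show Fintype.card (U i) - 1 = 1 by omega, Nat.dvd_one] at hd
      exact CharP.char_ne_one F p hd
    exact hval ⟨i, by_contra fun hb => h ⟨⟨ha1, hcard⟩, hb⟩, hd⟩
  · intro h
    -- The only possible middle index: `b` has to be `a° \ W`.
    let b : Fin n → Fin 2 := fun i => if i ∈ big U (supp a) \ classSet t then 1 else 0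
    have hb : supp b = big U (supp a) \ classSet t := by
      ext i
      simp [supp, b]
    have hsub : classSet t ⊆ big U (supp a) := fun i hi => by
      simp [big, supp, (h i).1 hi, two_lt_card_of_mem_classSet hi]
    have hreg : (a, b, a) ∈ regularTriples U p := by
      refine ⟨⟨by simp, ?_⟩, ?_⟩
      · simp only [hb, Finset.inter_self]
        exact Finset.sdiff_subset.trans Finset.subset_union_right
      · rw [dvd_valency_scheme_iff U p F]
        rintro ⟨i, hi, hd⟩
        have hi' : i ∈ supp b := Finset.mem_filter.2 ⟨Finset.mem_univ i, hi⟩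
        rw [hb, Finset.mem_sdiff] at hi'
        have h0 := (h i).2 hi'.2 hd
        simp [big, supp, h0] at hi'
    refine ⟨b, hreg, Quotient.sound (show classSet _ = classSet t from ?_)⟩
    simp only [classSet, hb, Finset.inter_self] at hsub ⊢
    exact Finset.sdiff_sdiff_eq_self hsub

end Factorial

theorem theorem8p11 {F : Type*} [Field F] (p : ℕ) [CharP F p] {n : ℕ} (hn : 1 ≤ n)
    (U : Fin n → Type*) [∀ i, Fintype (U i)] [∀ i, DecidableEq (U i)] [∀ i, Nontrivial (U i)]
    (x : ∀ i, U i) :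
    Nonempty
      ((((Factorial.scheme U).terwilligerAlgebra F x) ⧸
          Ring.jacobson ((Factorial.scheme U).terwilligerAlgebra F x)) ≃ₐ[F]
        (∀ m : Factorial.Classes U p,
          Matrix (Fin (Nat.card (Factorial.diagIndices U p m)))
            (Fin (Nat.card (Factorial.diagIndices U p m))) F)) := by
  choose ψ hψ hker using fun i => TrivialScheme.exists_algHom_blocks (F := F) p (x i)
  obtain ⟨e⟩ := (AssocScheme.isTensorDecomposition_terwilligerTensor F
    (fun i => AssocScheme.trivialScheme (U i)) x).nonempty_quotient_jacobson_algEquiv ψ hψ hker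
  let f : Factorial.Classes U p ≃ ∀ i, TrivialScheme.Block (U i) :=
    Equiv.ofBijective Factorial.blockOfClass (Factorial.bijective_blockOfClass F)
  let g : ∀ m : Factorial.Classes U p, (∀ i, TrivialScheme.BlockIndex p (f m i)) ≃
      Fin (Nat.card (Factorial.diagIndices U p m)) := fun m =>
    Equiv.subtypePiEquivPi.symm.trans ((Equiv.subtypeEquivRight fun a =>
      (Factorial.mem_diagIndices_iff F m a).symm).trans (Finite.equivFin _))
  exact ⟨e.trans ((AlgEquiv.piCongrLeft F _ f).symm.trans
    (AlgEquiv.piCongrRight fun m => Matrix.reindexAlgEquiv F F (g m)))⟩
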